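/- Let $q$ be a prime power, $n\ge 1$, and let $f(x)=\sum_{i=0}^{n-1}a_i x^{q^i}\in\mathbb F_{q^n}[x]$ be a $q$-polynomial. Put $U_f=\{(x,f(x)) : x\in\mathbb F_{q^n}\}$, an $\mathbb F_q$-subspace of $\mathbb F_{q^n}^2$, and let $L_f=\{\langle (x,f(x))\rangle_{\mathbb F_{q^n}} : x\in\mathbb F_{q^n}\setminus\{0\}\}\subseteq \mathrm{PG}(1,q^n)$ be the associated linear set. The weight of a point $\langle (a,b)\rangle_{\mathbb F_{q^n}}$ with respect to $U_f$ is $\dim_{\mathbb F_q}\bigl(\langle (a,b)\rangle_{\mathbb F_{q^n}}\cap U_f\bigr)$, and $f$ is called scattered if the set $\{f(x)/x : x\in\mathbb F_{q^n}\setminus\{0\}\}$ has the maximum possible size $(q^n-1)/(q-1)$. With $y$ a variable, let $H=(h_{ij})_{0\le i,j\le n-1}$ be the $n\times n$ matrix with $h_{ii}=y^{q^i}$ and $h_{ij}=a_{(j-i)\bmod n}^{q^i}$ for $i\ne j$, that is, \[H=\begin{pmatrix} y & a_1 & \ldots & a_{n-1}\\ a_{n-1}^q & y^q & \ldots & a_{n-2}^q\\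 \vdots & \vdots & \ddots & \vdots\\ a_1^{q^{n-1}} & a_2^{q^{n-1}} & \ldots & y^{q^{n-1}} \end{pmatrix}.\] For $0\le m\le n$ let $H_m(y)\in\mathbb F_{q^n}[y]$ be the determinant of the $(n-m)\times(n-m)$ matrix obtained from $H$ by removing its first $m$ columns and its last $m$ rows (so $H_n(y)=1$, the empty determinant). Roots are taken in an algebraic closure of $\mathbb F_{q^n}$ and counted without multiplicity. Then: 1. all roots of $H_0(y)$ lie in $\mathbb F_{q^n}$; 2. for every $1\le\mu\le n$, the number of points of $L_f$ of weight $\mu$ with respect to $U_f$ equals the number of common roots of $H_0(y),H_1(y),\ldots,H_{\mu-1}(y)$ that are not roots of $H_\mu(y)$; 3. in particular, $f$ is scattered if and only if $H_0(y)$ and $H_1(y)$ have no common root. -/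

import Mathlib

open Polynomial

noncomputable section

/-- The `q`-polynomial `a₀ x + a₁ x^q + ⋯ + aₙ₋₁ x^(q^(n-1))`. -/
def qPoly {L : Type*} [Field L] (q : ℕ) {n : ℕ} (a : Fin n → L) : L[X] :=
  ∑ i : Fin n, C (a i) * X ^ q ^ (i : ℕ)

theorem qPoly_eval {L : Type*} [Field L] (q : ℕ) {n : ℕ} (a : Fin n → L) (x : L) :
    (qPoly q a).eval x = ∑ i : Fin n, a i * x ^ q ^ (i : ℕ) := by
  simp [qPoly, eval_finsetSum]

/-- The map `x ↦ f(x)` given by a `q`-polynomial `f` with coefficients `a`, where `q = |K|`,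
as a `K`-linear transformation of `L`. -/
def qMap (K : Type*) {L : Type*} [Field K] [Fintype K] [Field L] [Algebra K L] {n : ℕ}
    (a : Fin n → L) : L →ₗ[K] L where
  toFun x := (qPoly (Fintype.card K) a).eval x
  map_add' x y := by
    have h (i : ℕ) : (x + y) ^ Fintype.card K ^ i
        = x ^ Fintype.card K ^ i + y ^ Fintype.card K ^ i := by
      induction i with
      | zero => simp
      | succ i ih =>
        simp only [pow_succ, pow_mul, ih]
        exact map_add (FiniteField.frobeniusAlgHom K L) _ _
    simp only [qPoly_eval, h, mul_add, Finset.sum_add_distrib]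
  map_smul' c x := by
    simp only [qPoly_eval, _root_.smul_pow, FiniteField.pow_card_pow, RingHom.id_apply,
      Finset.smul_sum, mul_smul_comm]

/-- `U_f = {(x, f(x)) : x ∈ L}`, a `K`-subspace of `L × L`. -/
def graphSubspace (K : Type*) {L : Type*} [Field K] [Fintype K] [Field L] [Algebra K L]
    {n : ℕ} (a : Fin n → L) : Submodule K (L × L) :=
  (qMap K a).graph

/-- `L_f`: the points of the projective line over `L` spanned by the vectors `(x, f(x))`
with `x ≠ 0`. -/
def linearSet (K : Type*) {L : Type*} [Field K] [Fintype K] [Field L] [Algebra K L]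
    {n : ℕ} (a : Fin n → L) : Set (Projectivization L (L × L)) :=
  {P | ∃ (x : L) (_ : x ≠ 0) (h : (x, qMap K a x) ≠ 0), P = Projectivization.mk L (x, qMap K a x) h}

/-- The weight of a point `P` of the projective line over `L` with respect to a `K`-subspace `U`
of `L × L`: the `K`-dimension of the intersection of `P` with `U`. -/
def pointWeight {K L : Type*} [Field K] [Field L] [Algebra K L]
    (U : Submodule K (L × L)) (P : Projectivization L (L × L)) : ℕ :=
  Module.finrank K ↥(P.submodule.restrictScalars K ⊓ U)

/-- `f` is scattered: the set of directions `{f(x)/x : x ≠ 0}` has the maximum possible size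
`(q^n - 1)/(q - 1)`, where `q = |K|` and `n = [L : K]`. -/
def IsScatteredQPoly (K : Type*) {L : Type*} [Field K] [Fintype K] [Field L] [Algebra K L]
    {n : ℕ} (a : Fin n → L) : Prop :=
  {d : L | ∃ x : L, x ≠ 0 ∧ d = qMap K a x / x}.encard =
    (((Fintype.card K ^ Module.finrank K L - 1) / (Fintype.card K - 1) : ℕ) : ℕ∞)

/-- The matrix `H`: the Dickson matrix, whose `(i, j)` entry is `a_(j - i mod n) ^ (q^i)`
(rows and columns indexed from `0`), with its diagonal entries replaced by `y ^ (q^i)`. The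
subtraction is that of `Fin n`, that is, modulo `n`. -/
def dicksonH {L : Type*} [Field L] (q : ℕ) {n : ℕ} (a : Fin n → L) :
    Matrix (Fin n) (Fin n) L[X] :=
  Matrix.of fun i j => if i = j then X ^ q ^ (i : ℕ) else C (a (j - i) ^ q ^ (i : ℕ))

/-- `H_m(y)`: the determinant of the matrix obtained from `H` by removing its first `m` columns and
its last `m` rows (for `m = n` the empty determinant `1`). -/
def dicksonMinor {L : Type*} [Field L] (q : ℕ) {n : ℕ} (a : Fin n → L) (m : ℕ) : L[X] :=
  ((dicksonH q a).submatrix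
    (fun i : Fin (n - m) => (⟨i, by omega⟩ : Fin n))
    (fun j : Fin (n - m) => (⟨m + j, by omega⟩ : Fin n))).det

end

/-! For `z` in an extension `F` of `L`, let `g(x) = f(x) + (z - a 0) x`, a `K`-linear map `L → F`.
Then `H(z)` is the Dickson matrix of `g`: row `i` holds the coefficients of `g ^ (q ^ i)` modulo `x
^ (q ^ n) - x`. A combination `b` of the first `n - m` rows thus gives the coefficients of `b ∘ g`,
with `b` a `q`-polynomial of `q`-degree below `n - m`; it kills the columns of `H_m` iff `b ∘ g` has
`q`-degree below `m`. Counting zeros of `b` and `b ∘ g` shows that `dim ker g` is the index of the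
first minor not vanishing at `z` (`dicksonMinor_first_nonzero_iff`). If `ker g ≠ 0` then `z = a 0 -
d` with `d = f(x)/x` in `L`, and `ker g = {x | f(x) = d x}` has as dimension the weight of `⟨(1,
d)⟩`. Scatteredness says that these dimensions are at most 1, by counting fibres of `f(x)/x`. -/

theorem qMap_apply (K : Type*) {L : Type*} [Field K] [Fintype K] [Field L] [Algebra K L] {n : ℕ}
    (a : Fin n → L) (x : L) :
    qMap K a x = ∑ i, a i * x ^ Fintype.card K ^ (i : ℕ) :=
  qPoly_eval _ _ _

theorem qPoly_coeff_pow {L : Type*} [Field L] {q : ℕ} (hq : 1 < q) {n : ℕ} (a : Fin n → L)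
    (i : Fin n) : (qPoly q a).coeff (q ^ (i : ℕ)) = a i := by
  have h (j : Fin n) : q ^ (i : ℕ) = q ^ (j : ℕ) ↔ i = j :=
    ⟨fun h => Fin.ext (Nat.pow_right_injective hq h), fun h => h ▸ rfl⟩
  simp [qPoly, finsetSum_coeff, coeff_X_pow, h]

theorem qPoly_natDegree_lt {L : Type*} [Field L] {q : ℕ} (hq : 1 < q) {n : ℕ} (a : Fin n → L) :
    (qPoly q a).natDegree < q ^ n := by
  refine lt_of_le_of_lt (b := q ^ n - 1) (natDegree_sum_le_of_forall_le _ _ fun i _ => ?_)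
    (Nat.sub_lt (by positivity) one_pos)
  exact (natDegree_C_mul_X_pow_le _ _).trans
    (Nat.le_sub_one_of_lt (Nat.pow_lt_pow_right hq i.2))

/-- A `q`-polynomial of `q`-degree less than `m` with `q ^ m` zeros is zero. -/
theorem eq_zero_of_qMap_eq_zero {K F : Type*} [Field K] [Fintype K] [Field F] [Algebra K F]
    {m : ℕ} (b : Fin m → F) (s : Set F) (hfin : s.Finite) (hs : Fintype.card K ^ m ≤ s.ncard)
    (h : ∀ v ∈ s, qMap K b v = 0) : b = 0 := by
  have hq : 1 < Fintype.card K := Fintype.one_lt_card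
  have h0 : qPoly (Fintype.card K) b = 0 := by
    refine eq_zero_of_natDegree_lt_card_of_eval_eq_zero' _ hfin.toFinset (fun v hv => ?_) ?_
    · exact h v (by simpa using hv)
    · rw [← Set.ncard_eq_toFinset_card s hfin]
      exact (qPoly_natDegree_lt hq b).trans_le hs
  funext i
  rw [← qPoly_coeff_pow hq b i, h0]
  simp

/-- A subspace of dimension less than `m` is annihilated by a nonzero `q`-polynomial of
`q`-degree less than `m`. -/
theorem exists_qMap_eq_zero_of_finrank_lt {K F : Type*} [Field K] [Fintype K] [Field F]
    [Algebra K F] {m : ℕ} (W : Submodule K F) [FiniteDimensional K W]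
    (hW : Module.finrank K W < m) : ∃ b : Fin m → F, b ≠ 0 ∧ ∀ v ∈ W, qMap K b v = 0 := by
  let e := Module.finBasis K W
  let M : Matrix (Fin (Module.finrank K W)) (Fin m) F :=
    Matrix.of fun k i => (e k : F) ^ Fintype.card K ^ (i : ℕ)
  have hker : LinearMap.ker M.mulVecLin ≠ ⊥ :=
    LinearMap.ker_ne_bot_of_finrank_lt (by simpa using hW)
  obtain ⟨b, hb, hb0⟩ := Submodule.exists_mem_ne_zero_of_ne_bot hker
  refine ⟨b, hb0, fun v hv => ?_⟩
  have h : (qMap K b).comp W.subtype = 0 := by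
    refine e.ext fun k => ?_
    have := congrFun (LinearMap.mem_ker.1 hb) k
    simpa [qMap_apply, M, Matrix.mulVec, dotProduct, mul_comm] using this
  exact LinearMap.congr_fun h ⟨v, hv⟩

/-! ### Dickson matrices and composition of `q`-polynomials -/

/-- The Dickson matrix of a `q`-polynomial. -/
def dicksonMatrix {F : Type*} [Field F] (q : ℕ) {n : ℕ} (A : Fin n → F) :
    Matrix (Fin n) (Fin n) F :=
  Matrix.of fun i j => A (j - i) ^ q ^ (i : ℕ)

/-- The Dickson matrix without its first `m` columns and its last `m` rows. -/
def dicksonSubmatrix {F : Type*} [Field F] (q : ℕ) {n : ℕ} (A : Fin n → F) (m : ℕ) :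
    Matrix (Fin (n - m)) (Fin (n - m)) F :=
  (dicksonMatrix q A).submatrix (fun i => ⟨i, by omega⟩) (fun j => ⟨m + j, by omega⟩)

/-- The coefficient of index 0 occurs exactly on the diagonal, so `y = z` amounts to replacing `a 0`
by `z`. -/
theorem aeval_dicksonMinor {L F : Type*} [Field L] [Field F] [Algebra L F] (q : ℕ) {n : ℕ}
    [NeZero n] (a : Fin n → L) (m : ℕ) (z : F) :
    aeval z (dicksonMinor q a m) =
      (dicksonSubmatrix q (Function.update (fun i => algebraMap L F (a i)) 0 z) m).det := by
  rw [dicksonMinor, AlgHom.map_det]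
  congr 1
  ext i j
  simp only [AlgHom.mapMatrix_apply, Matrix.map_apply, Matrix.submatrix_apply, dicksonH,
    dicksonSubmatrix, dicksonMatrix, Matrix.of_apply, Function.update_apply, sub_eq_zero]
  split_ifs with h1 h2 h2
  · simp
  · exact absurd h1.symm h2
  · exact absurd h2.symm h1
  · simp

/-- The `q`-polynomial with coefficients `A`, restricted to a subfield. -/
noncomputable def qMapRestrict (K L : Type*) {F : Type*} [Field K] [Fintype K] [Field L] [Algebra K L] [Field F]
    [Algebra L F] [Algebra K F] [IsScalarTower K L F] {n : ℕ} (A : Fin n → F) : L →ₗ[K] F :=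
  (qMap K A).comp (IsScalarTower.toAlgHom K L F).toLinearMap

theorem qMapRestrict_apply {K L F : Type*} [Field K] [Fintype K] [Field L] [Algebra K L] [Field F]
    [Algebra L F] [Algebra K F] [IsScalarTower K L F] {n : ℕ} (A : Fin n → F) (x : L) :
    qMapRestrict K L A x = qMap K A (algebraMap L F x) := rfl

theorem sum_pow_card_pow (K : Type*) {F ι : Type*} [Field K] [Fintype K] [Field F] [Algebra K F]
    (s : Finset ι) (g : ι → F) (i : ℕ) :
    (∑ k ∈ s, g k) ^ Fintype.card K ^ i = ∑ k ∈ s, g k ^ Fintype.card K ^ i := by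
  induction i with
  | zero => simp
  | succ i ih =>
    simp only [pow_succ, pow_mul, ih]
    exact map_sum (FiniteField.frobeniusAlgHom K F) _ _

theorem pow_card_pow_mod {K L : Type*} [Field K] [Fintype K] [Field L] [Finite L] [Algebra K L]
    {n : ℕ} (hn : Module.finrank K L = n) (x : L) (i : ℕ) :
    x ^ Fintype.card K ^ (i % n) = x ^ Fintype.card K ^ i := by
  have hx : x ^ Fintype.card K ^ n = x := by
    have := Fintype.ofFinite L
    rw [← hn, ← Module.card_eq_pow_finrank, FiniteField.pow_card]
  have hx' (k : ℕ) : x ^ Fintype.card K ^ (n * k) = x := by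
    induction k with
    | zero => simp
    | succ k ih => rw [Nat.mul_succ, pow_add, pow_mul, ih, hx]
  conv_rhs => rw [← Nat.div_add_mod i n, pow_add, pow_mul, hx']

/-- The rows of the Dickson matrix hold the coefficients of the `q`-powers of the
`q`-polynomial, reduced modulo `x ^ (q ^ n) - x`. -/
theorem qMapRestrict_pow {K L F : Type*} [Field K] [Fintype K] [Field L] [Finite L]
    [Algebra K L] [Field F] [Algebra L F] [Algebra K F] [IsScalarTower K L F] {n : ℕ}
    (hn : Module.finrank K L = n) (A : Fin n → F) (i : Fin n) (x : L) :
    qMapRestrict K L A x ^ Fintype.card K ^ (i : ℕ) =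
      qMapRestrict K L (dicksonMatrix (Fintype.card K) A i) x := by
  have : NeZero n := ⟨by have := i.2; omega⟩
  rw [qMapRestrict_apply, qMapRestrict_apply, qMap_apply, qMap_apply, sum_pow_card_pow]
  refine Fintype.sum_equiv (Equiv.addRight i) _ _ fun k => ?_
  -- Exponents wrap modulo `n` because the argument lies in `L`; the coefficients in `F` need not be
  -- fixed by the `q ^ n`-power map.
  have h : (algebraMap L F x) ^ Fintype.card K ^ ((k + i : Fin n) : ℕ) =
      (algebraMap L F x) ^ Fintype.card K ^ ((k : ℕ) + i) := by
    rw [Fin.val_add, ← map_pow, pow_card_pow_mod hn, map_pow]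
  simp only [Equiv.coe_addRight, dicksonMatrix, Matrix.of_apply, add_sub_cancel_right, h]
  rw [mul_pow, ← pow_mul, ← pow_add]

theorem qMap_qMapRestrict {K L F : Type*} [Field K] [Fintype K] [Field L] [Finite L]
    [Algebra K L] [Field F] [Algebra L F] [Algebra K F] [IsScalarTower K L F] {n r : ℕ}
    (hn : Module.finrank K L = n) (A : Fin n → F) (hr : r ≤ n) (b : Fin r → F) (x : L) :
    qMap K b (qMapRestrict K L A x) =
      qMapRestrict K L (fun j => ∑ i, b i *
        dicksonMatrix (Fintype.card K) A (Fin.castLE hr i) j) x := by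
  rw [qMap_apply]
  have h (i : Fin r) := qMapRestrict_pow hn A (Fin.castLE hr i) x
  simp only [Fin.val_castLE] at h
  simp only [h]
  simp only [qMapRestrict_apply, qMap_apply, Finset.mul_sum, Finset.sum_mul]
  rw [Finset.sum_comm]
  simp only [mul_assoc]

theorem ncard_coe_eq_pow_finrank {K V : Type*} [Field K] [Fintype K] [AddCommGroup V] [Module K V]
    (W : Submodule K V) [FiniteDimensional K W] :
    (W : Set V).ncard = Fintype.card K ^ Module.finrank K W := by
  rw [← Nat.card_eq_fintype_card (α := K), ← Module.natCard_eq_pow_finrank (K := K) (V := W)]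
  rfl

/-! ### Minors and the dimension of the kernel -/

/-- The minors of the Dickson matrix vanish below the dimension of the kernel. -/
theorem dicksonSubmatrix_det_eq_zero {K L F : Type*} [Field K] [Fintype K] [Field L] [Finite L]
    [Algebra K L] [Field F] [Algebra L F] [Algebra K F] [IsScalarTower K L F] {n m : ℕ}
    (hn : Module.finrank K L = n) (A : Fin n → F)
    (hm : m < Module.finrank K (LinearMap.ker (qMapRestrict K L A))) :
    (dicksonSubmatrix (Fintype.card K) A m).det = 0 := by
  have hfd : FiniteDimensional K L := Module.Finite.of_finite
  have hrk := LinearMap.finrank_range_add_finrank_ker (qMapRestrict K L A)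
  obtain ⟨b, hb0, hb⟩ := exists_qMap_eq_zero_of_finrank_lt (m := n - m)
    (LinearMap.range (qMapRestrict K L A)) (by omega)
  -- `b ∘ g` vanishes at all `q ^ n` elements of `L`, so `b` kills every column, in particular those
  -- kept in the minor.
  have hc := eq_zero_of_qMap_eq_zero (K := K) (fun j => ∑ i, b i *
      dicksonMatrix (Fintype.card K) A (Fin.castLE (Nat.sub_le n m) i) j)
    (Set.range (algebraMap L F)) (Set.finite_range _) (by
      rw [← Set.image_univ, Set.ncard_image_of_injective _ (algebraMap L F).injective,
        Set.ncard_univ, Module.natCard_eq_pow_finrank (K := K), hn, Nat.card_eq_fintype_card])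
    (by
      rintro _ ⟨x, rfl⟩
      rw [← qMapRestrict_apply, ← qMap_qMapRestrict hn]
      exact hb _ ⟨x, rfl⟩)
  refine Matrix.exists_vecMul_eq_zero_iff.1 ⟨b, hb0, funext fun j => ?_⟩
  exact congrFun hc ⟨m + j, by omega⟩

/-- The first minor of the Dickson matrix that does not vanish is at the dimension of the
kernel. -/
theorem dicksonSubmatrix_det_ne_zero {K L F : Type*} [Field K] [Fintype K] [Field L] [Finite L]
    [Algebra K L] [Field F] [Algebra L F] [Algebra K F] [IsScalarTower K L F] {n m : ℕ}
    (hn : Module.finrank K L = n) (A : Fin n → F)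
    (hm : Module.finrank K (LinearMap.ker (qMapRestrict K L A)) = m) :
    (dicksonSubmatrix (Fintype.card K) A m).det ≠ 0 := by
  have hfd : FiniteDimensional K L := Module.Finite.of_finite
  have hrk := LinearMap.finrank_range_add_finrank_ker (qMapRestrict K L A)
  have hmn : m ≤ n := by omega
  intro hdet
  obtain ⟨b, hb0, hb⟩ := Matrix.exists_vecMul_eq_zero_iff.2 hdet
  set c : Fin n → F := fun j => ∑ i, b i *
      dicksonMatrix (Fintype.card K) A (Fin.castLE (Nat.sub_le n m) i) j with hc
  have hcm (j : Fin n) (hj : m ≤ j) : c j = 0 := by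
    have h := congrFun hb ⟨j - m, by omega⟩
    have hj' : (⟨m + (j - m), by omega⟩ : Fin n) = j := Fin.ext (by simp; omega)
    simp only [Matrix.vecMul, dotProduct, dicksonSubmatrix, Matrix.submatrix_apply, hj'] at h
    exact h
  have hred (v : F) : qMap K c v = qMap K (fun j : Fin m => c (Fin.castLE hmn j)) v := by
    rw [qMap_apply, qMap_apply]
    obtain ⟨k, rfl⟩ := Nat.exists_eq_add_of_le hmn
    rw [Fin.sum_univ_add, Finset.sum_eq_zero (s := Finset.univ (α := Fin k))
      fun j _ => by rw [hcm _ (by simp), zero_mul], add_zero]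
    rfl
  -- `b ∘ g` has `q`-degree below `m`, but `q ^ m` zeros in `ker g`.
  have hc0 := eq_zero_of_qMap_eq_zero (K := K) (fun j : Fin m => c (Fin.castLE hmn j))
    (algebraMap L F '' LinearMap.ker (qMapRestrict K L A)) (Set.toFinite _) (by
      rw [Set.ncard_image_of_injective _ (algebraMap L F).injective, ncard_coe_eq_pow_finrank, hm])
    (by
      rintro _ ⟨x, hx, rfl⟩
      rw [← hred, ← qMapRestrict_apply, hc, ← qMap_qMapRestrict hn, LinearMap.mem_ker.1 hx,
        map_zero])
  -- Now `b`, of `q`-degree below `n - m`, vanishes on the range of `g`, which has `q ^ (n - m)`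
  -- elements.
  refine hb0 (eq_zero_of_qMap_eq_zero (K := K) b (LinearMap.range (qMapRestrict K L A))
    ?_ ?_ ?_)
  · rw [LinearMap.coe_range]
    exact Set.finite_range _
  · rw [ncard_coe_eq_pow_finrank]
    exact Nat.pow_le_pow_right Fintype.card_pos (by omega)
  · rintro _ ⟨x, rfl⟩
    rw [qMap_qMapRestrict hn _ (Nat.sub_le n m), qMapRestrict_apply, hred, hc0, qMap_apply]
    simp

theorem dicksonMinor_first_nonzero_iff {K L F : Type*} [Field K] [Fintype K] [Field L] [Finite L]
    [Algebra K L] [Field F] [Algebra L F] [Algebra K F] [IsScalarTower K L F] {n : ℕ} [NeZero n]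
    (hn : Module.finrank K L = n) (a : Fin n → L) (z : F) (μ : ℕ) :
    ((∀ m < μ, aeval z (dicksonMinor (Fintype.card K) a m) = 0) ∧
        aeval z (dicksonMinor (Fintype.card K) a μ) ≠ 0) ↔
      Module.finrank K (LinearMap.ker (qMapRestrict K L
        (Function.update (fun i => algebraMap L F (a i)) 0 z))) = μ := by
  simp only [aeval_dicksonMinor]
  refine ⟨fun ⟨h0, h1⟩ => ?_, fun h => ⟨fun m hm => ?_, dicksonSubmatrix_det_ne_zero hn _ h⟩⟩
  · refine le_antisymm (not_lt.1 fun h => h1 (dicksonSubmatrix_det_eq_zero hn _ h))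
      (not_lt.1 fun h => dicksonSubmatrix_det_ne_zero hn _ rfl (h0 _ h))
  · exact dicksonSubmatrix_det_eq_zero hn _ (hm.trans_eq h.symm)

/-! ### Roots, directions and points of the linear set -/

theorem qMapRestrict_update {K L F : Type*} [Field K] [Fintype K] [Field L]
    [Algebra K L] [Field F] [Algebra L F] [Algebra K F] [IsScalarTower K L F] {n : ℕ} [NeZero n]
    (a : Fin n → L) (z : F) (x : L) :
    qMapRestrict K L (Function.update (fun i => algebraMap L F (a i)) 0 z) x =
      algebraMap L F (qMap K a x) + (z - algebraMap L F (a 0)) * algebraMap L F x := by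
  rw [qMapRestrict_apply, qMap_apply, qMap_apply, map_sum, ← sub_eq_iff_eq_add',
    ← Finset.sum_sub_distrib, Finset.sum_eq_single 0]
  · simp [sub_mul]
  · intro i _ hi
    simp [Function.update_of_ne hi]
  · simp

/-- The vectors `x` with `f(x) = d * x`. -/
noncomputable def directionSpace (K : Type*) {L : Type*} [Field K] [Fintype K] [Field L]
    [Algebra K L] {n : ℕ} (a : Fin n → L) (d : L) : Submodule K L :=
  LinearMap.ker (qMap K a - LinearMap.mulLeft K d)

theorem mem_directionSpace {K L : Type*} [Field K] [Fintype K] [Field L]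
    [Algebra K L] {n : ℕ} {a : Fin n → L} {d x : L} :
    x ∈ directionSpace K a d ↔ qMap K a x = d * x := by
  simp [directionSpace, sub_eq_zero]

theorem ker_qMapRestrict_update {K L F : Type*} [Field K] [Fintype K] [Field L]
    [Algebra K L] [Field F] [Algebra L F] [Algebra K F] [IsScalarTower K L F] {n : ℕ} [NeZero n]
    (a : Fin n → L) (d : L) :
    LinearMap.ker (qMapRestrict K L (Function.update (fun i => algebraMap L F (a i)) 0
      (algebraMap L F (a 0 - d)))) = directionSpace K a d := by
  ext x
  rw [LinearMap.mem_ker, qMapRestrict_update, mem_directionSpace, ← map_sub, ← map_mul, ← map_add,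
    map_eq_zero, sub_sub_cancel_left, neg_mul, ← sub_eq_add_neg, sub_eq_zero]

theorem exists_eq_of_finrank_ker_ne_zero {K L F : Type*} [Field K] [Fintype K] [Field L]
    [Algebra K L] [Field F] [Algebra L F] [Algebra K F] [IsScalarTower K L F] {n : ℕ} [NeZero n]
    (a : Fin n → L) (z : F) (h : Module.finrank K (LinearMap.ker (qMapRestrict K L
      (Function.update (fun i => algebraMap L F (a i)) 0 z))) ≠ 0) :
    ∃ d : L, z = algebraMap L F (a 0 - d) := by
  obtain ⟨x, hx, hx0⟩ := Submodule.exists_mem_ne_zero_of_ne_bot (fun h0 => h (by rw [h0]; simp) :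
    LinearMap.ker (qMapRestrict K L (Function.update (fun i => algebraMap L F (a i)) 0 z)) ≠ ⊥)
  rw [LinearMap.mem_ker, qMapRestrict_update] at hx
  have hx0' : algebraMap L F x ≠ 0 := by simpa using hx0
  refine ⟨qMap K a x / x, ?_⟩
  rw [map_sub, map_div₀]
  field_simp
  linear_combination hx

/-- The point `⟨(1, d)⟩` of the projective line. -/
noncomputable def directionPoint {L : Type*} [Field L] (d : L) : Projectivization L (L × L) :=
  Projectivization.mk L (1, d) (by simp)

theorem directionPoint_injective {L : Type*} [Field L] :
    Function.Injective (directionPoint (L := L)) := by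
  intro d e h
  obtain ⟨c, hc⟩ := (Projectivization.mk_eq_mk_iff' _ _ _ _ _).1 h
  simp only [Prod.smul_mk, smul_eq_mul, mul_one, Prod.mk.injEq] at hc
  simpa [hc.1] using hc.2.symm

theorem mk_eq_directionPoint {L : Type*} [Field L] {x y : L} (hx : x ≠ 0) (h : (x, y) ≠ 0) :
    Projectivization.mk L (x, y) h = directionPoint (y / x) := by
  refine (Projectivization.mk_eq_mk_iff' _ _ _ _ _).2 ⟨x, ?_⟩
  simp [mul_div_cancel₀ _ hx]

theorem directionPoint_mem_linearSet {K L : Type*} [Field K] [Fintype K] [Field L]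
    [Algebra K L] {n : ℕ} {a : Fin n → L} {d : L} :
    directionPoint d ∈ linearSet K a ↔ directionSpace K a d ≠ ⊥ := by
  rw [Submodule.ne_bot_iff]
  constructor
  · rintro ⟨x, hx, h, he⟩
    rw [mk_eq_directionPoint hx] at he
    refine ⟨x, ?_, hx⟩
    rw [mem_directionSpace, directionPoint_injective he, div_mul_cancel₀ _ hx]
  · rintro ⟨x, hx, hx0⟩
    refine ⟨x, hx0, by simp [hx0], ?_⟩
    rw [mk_eq_directionPoint hx0, mem_directionSpace.1 hx, mul_div_cancel_right₀ _ hx0]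

theorem pointWeight_directionPoint {K L : Type*} [Field K] [Fintype K] [Field L]
    [Algebra K L] {n : ℕ} (a : Fin n → L) (d : L) :
    pointWeight (graphSubspace K a) (directionPoint d) =
      Module.finrank K (directionSpace K a d) := by
  let φ : L →ₗ[K] L × L := LinearMap.prod LinearMap.id (LinearMap.mulLeft K d)
  have hφx (x : L) : φ x = (x, d * x) := rfl
  have hφ : Function.Injective φ := fun x y h => congrArg Prod.fst h
  have h : (directionPoint d).submodule.restrictScalars K ⊓ graphSubspace K a =
      (directionSpace K a d).map φ := by
    ext ⟨x, y⟩
    simp only [Submodule.mem_inf, Submodule.restrictScalars_mem, directionPoint,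
      Projectivization.submodule_mk, Submodule.mem_span_singleton, graphSubspace,
      LinearMap.mem_graph_iff, Submodule.mem_map, mem_directionSpace, hφx, Prod.mk.injEq,
      Prod.smul_mk, smul_eq_mul, mul_one]
    constructor
    · rintro ⟨⟨c, rfl, rfl⟩, h⟩
      exact ⟨c, by rw [← h, mul_comm], rfl, mul_comm _ _⟩
    · rintro ⟨c, h, rfl, rfl⟩
      exact ⟨⟨c, rfl, mul_comm _ _⟩, h.symm⟩
  rw [pointWeight, h]
  exact (Submodule.equivMapOfInjective φ hφ _).finrank_eq.symm

/-- Positivity of `μ` excludes the points `⟨(1, d)⟩` outside the linear set, which have weight 0. -/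
theorem linearSet_weight_eq_image {K L : Type*} [Field K] [Fintype K] [Field L] [Finite L]
    [Algebra K L] {n : ℕ} (a : Fin n → L) {μ : ℕ} (hμ : 1 ≤ μ) :
    {P | P ∈ linearSet K a ∧ pointWeight (graphSubspace K a) P = μ} =
      directionPoint '' {d | Module.finrank K (directionSpace K a d) = μ} := by
  ext P
  constructor
  · rintro ⟨⟨x, hx, h, rfl⟩, hw⟩
    rw [mk_eq_directionPoint hx] at hw ⊢
    rw [pointWeight_directionPoint] at hw
    exact ⟨_, hw, rfl⟩
  · rintro ⟨d, hd, rfl⟩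
    refine ⟨directionPoint_mem_linearSet.2 fun h => ?_, (pointWeight_directionPoint a d).trans hd⟩
    rw [Set.mem_ofPred_eq, h, finrank_bot] at hd
    omega

theorem finrank_ker_eq_set_eq_image {K L F : Type*} [Field K] [Fintype K] [Field L]
    [Algebra K L] [Field F] [Algebra L F] [Algebra K F] [IsScalarTower K L F] {n : ℕ} [NeZero n]
    (a : Fin n → L) {μ : ℕ} (hμ : 1 ≤ μ) :
    {z : F | Module.finrank K (LinearMap.ker (qMapRestrict K L
        (Function.update (fun i => algebraMap L F (a i)) 0 z))) = μ} =
      (fun d => algebraMap L F (a 0 - d)) ''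
        {d | Module.finrank K (directionSpace K a d) = μ} := by
  ext z
  constructor
  · rintro (hz : _ = μ)
    obtain ⟨d, rfl⟩ := exists_eq_of_finrank_ker_ne_zero a z (hz.trans_ne (by omega))
    rw [ker_qMapRestrict_update] at hz
    exact ⟨d, hz, rfl⟩
  · rintro ⟨d, hd, rfl⟩
    rw [Set.mem_ofPred_eq, ker_qMapRestrict_update]
    exact hd

/-! ### Scatteredness and the conclusion -/

/-- The `q ^ n - 1` nonzero vectors split into fibres of `f(x)/x`, each of size `q ^ k - 1 ≥ q - 1`
with `k` the dimension of the direction space. There are `(q ^ n - 1)/(q - 1)` fibres iff every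
inequality is an equality. -/
theorem isScatteredQPoly_iff {K L : Type*} [Field K] [Fintype K] [Field L] [Finite L]
    [Algebra K L] {n : ℕ} (a : Fin n → L) :
    IsScatteredQPoly K a ↔ ∀ d, Module.finrank K (directionSpace K a d) ≤ 1 := by
  classical
  have := Fintype.ofFinite L
  have hfd : FiniteDimensional K L := Module.Finite.of_finite
  have hq : 1 < Fintype.card K := Fintype.one_lt_card
  set q := Fintype.card K with hqdef
  let s : Finset L := Finset.univ.erase 0
  let S : Finset L := s.image fun x => qMap K a x / x
  have hset : {d : L | ∃ x : L, x ≠ 0 ∧ d = qMap K a x / x} = S := by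
    ext d
    simp [S, s, eq_comm]
  have hfiber (d : L) : (s.filter fun x => qMap K a x / x = d).card =
      q ^ Module.finrank K (directionSpace K a d) - 1 := by
    have h : (s.filter fun x => qMap K a x / x = d) =
        (Finset.univ.filter (· ∈ directionSpace K a d)).erase 0 := by
      ext x
      simp only [s, Finset.mem_filter, Finset.mem_erase, Finset.mem_univ, and_true, true_and,
        mem_directionSpace]
      exact and_congr_right fun hx => div_eq_iff hx
    rw [h, Finset.card_erase_of_mem (by simp), hqdef, ← ncard_coe_eq_pow_finrank,
      Set.ncard_eq_toFinset_card']
    congr 2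
    ext x
    simp
  have hpos (d : L) (hd : d ∈ S) : 1 ≤ Module.finrank K (directionSpace K a d) := by
    obtain ⟨x, hx, rfl⟩ := Finset.mem_image.1 hd
    have hx0 : x ≠ 0 := by simpa [s] using hx
    refine Submodule.one_le_finrank_iff.2 ((Submodule.ne_bot_iff _).2 ⟨x, ?_, hx0⟩)
    rw [mem_directionSpace, div_mul_cancel₀ _ hx0]
  have hcard : q ^ Module.finrank K L - 1 =
      ∑ d ∈ S, (q ^ Module.finrank K (directionSpace K a d) - 1) := by
    rw [← Module.card_eq_pow_finrank, ← Finset.card_univ,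
      ← Finset.card_erase_of_mem (Finset.mem_univ (0 : L)),
      Finset.card_eq_sum_card_image (fun x => qMap K a x / x)]
    exact Finset.sum_congr rfl fun d _ => hfiber d
  have hdvd : q - 1 ∣ q ^ Module.finrank K L - 1 := by
    simpa using Nat.sub_dvd_pow_sub_pow q 1 (Module.finrank K L)
  have hle (d : L) (hd : d ∈ S) :
      q - 1 ≤ q ^ Module.finrank K (directionSpace K a d) - 1 :=
    Nat.sub_le_sub_right (Nat.le_self_pow (by have := hpos d hd; omega) q) 1
  have hiff : IsScatteredQPoly K a ↔ S.card * (q - 1) = q ^ Module.finrank K L - 1 := by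
    rw [IsScatteredQPoly, hset, Set.encard_coe_eq_coe_finsetCard, Nat.cast_inj,
      Nat.eq_div_iff_mul_eq_left (by omega) hdvd]
    exact eq_comm
  rw [hiff, hcard, ← smul_eq_mul, ← Finset.sum_const, Finset.sum_eq_sum_iff_of_le hle]
  constructor
  · intro h d
    by_contra! hd
    obtain ⟨x, hx, hx0⟩ := (Submodule.ne_bot_iff _).1
      (Submodule.one_le_finrank_iff.1 hd.le)
    have hdS : d ∈ S := Finset.mem_image.2 ⟨x, by simpa [s] using hx0, by
      rw [mem_directionSpace.1 hx, mul_div_cancel_right₀ _ hx0]⟩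
    have h1 : q - 1 = q ^ Module.finrank K (directionSpace K a d) - 1 := h d hdS
    have h2 : q ^ 1 < q ^ Module.finrank K (directionSpace K a d) :=
      Nat.pow_lt_pow_right hq hd
    rw [pow_one] at h2
    omega
  · intro h d hd
    rw [le_antisymm (h d) (hpos d hd), pow_one]

theorem corollary9 {K L : Type*} [Field K] [Fintype K] [Field L] [Finite L] [Algebra K L]
    (q n : ℕ) (hq : Fintype.card K = q) (hn : Module.finrank K L = n) (a : Fin n → L) :
    (∀ z : AlgebraicClosure L, aeval z (dicksonMinor q a 0) = 0 →
      z ∈ Set.range (algebraMap L (AlgebraicClosure L))) ∧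
    (∀ μ : ℕ, 1 ≤ μ → μ ≤ n →
      {P : Projectivization L (L × L) |
          P ∈ linearSet K a ∧ pointWeight (graphSubspace K a) P = μ}.encard =
        {z : AlgebraicClosure L | (∀ m < μ, aeval z (dicksonMinor q a m) = 0) ∧
          aeval z (dicksonMinor q a μ) ≠ 0}.encard) ∧
    (IsScatteredQPoly K a ↔
      ¬ ∃ z : AlgebraicClosure L,
        aeval z (dicksonMinor q a 0) = 0 ∧ aeval z (dicksonMinor q a 1) = 0) := by
  subst hq
  have hfd : FiniteDimensional K L := Module.Finite.of_finite
  have : NeZero n := ⟨hn ▸ Module.finrank_pos.ne'⟩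
  have hminor := dicksonMinor_first_nonzero_iff (F := AlgebraicClosure L) hn a
  have hroot (z : AlgebraicClosure L) (hz : aeval z (dicksonMinor (Fintype.card K) a 0) = 0) :
      ∃ d : L, z = algebraMap L (AlgebraicClosure L) (a 0 - d) :=
    exists_eq_of_finrank_ker_ne_zero (K := K) a z fun h => ((hminor z 0).2 h).2 hz
  refine ⟨fun z hz => ?_, fun μ hμ _ => ?_, ?_⟩
  · obtain ⟨d, rfl⟩ := hroot z hz
    exact ⟨_, rfl⟩
  · simp only [hminor]
    rw [linearSet_weight_eq_image a hμ, finrank_ker_eq_set_eq_image a hμ,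
      directionPoint_injective.encard_image, Function.Injective.encard_image]
    exact (algebraMap L (AlgebraicClosure L)).injective.comp sub_right_injective
  · rw [isScatteredQPoly_iff]
    constructor
    · rintro h ⟨z, h0, h1⟩
      obtain ⟨d, rfl⟩ := hroot z h0
      have hd := h d
      rw [← ker_qMapRestrict_update (F := AlgebraicClosure L)] at hd
      -- Dimension 0 would make `H_0` nonzero at the root, dimension 1 would make `H_1` nonzero.
      interval_cases hw : Module.finrank K (LinearMap.ker (qMapRestrict K L (Function.update
        (fun i => algebraMap L (AlgebraicClosure L) (a i)) 0
        (algebraMap L (AlgebraicClosure L) (a 0 - d)))))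
      · exact ((hminor _ _).2 hw).2 h0
      · exact ((hminor _ _).2 hw).2 h1
    · intro h d
      by_contra! hd
      rw [← ker_qMapRestrict_update (F := AlgebraicClosure L)] at hd
      have hmin := ((hminor (algebraMap L _ (a 0 - d)) _).2 rfl).1
      exact h ⟨_, hmin 0 (by omega), hmin 1 hd⟩
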